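/- Let $n\ge 0$ be an integer and let $W$ be the set of words (finite sequences) over the alphabet $a_1,\dots,a_n$, with empty word $\star$. **Kiselman's semigroup and canonical words.** $\mathrm K_n$ is the monoid generated by $a_1,\dots,a_n$ with relations $a_i^2=a_i$ for all $i$ and $a_ia_ja_i=a_ja_ia_j=a_ia_j$ for $i<j$; let $\pi\colon W\to \mathrm K_n$ be the evaluation of words. A word is *canonical* if in each of its blocks of consecutive letters of the form $a_iua_i$ the word $u$ contains some $a_j$ with $j>i$ and some $a_k$ with $k<i$. **Join.** For $u,v\in W$ let $[u,v]=u^+v$, where $u=u^+u^-$ and $u^-$ is the longest suffix of $u$ that is a (not necessarily contiguous) subsequence of $v$. **The update system $\mathcal S_n^\star$.** Let $\Gamma_n$ be the directed graph on $\{1,\dots,n\}$ with $i\to j$ if and only if $i<j$. Vertex $i$ has the finite state set $S_i\subset W$ defined by downward recursion by $S_i=\{\star\}\cup\{a_i[s_n,[\dots,[s_{i+2},s_{i+1}]\dots]] : s_j\in S_j \text{ for } j>i\}$; here the iterated join is $s_n$ if $i=n-1$ and $\star$ if $i=n$. Put $S=S_1\times\dots\times S_n$. Let $F_i\colon S\to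 S$ be the map that replaces the $i$-th entry of $(s_1,\dots,s_n)$ by $a_i[s_n,[\dots,[s_{i+2},s_{i+1}]\dots]]$ and leaves the other entries unchanged. For a word $w=a_{i_1}\cdots a_{i_k}$ put $F_w=F_{i_1}\circ\dots\circ F_{i_k}$, and let $D(\mathcal S_n^\star)$ be the monoid of self-maps of $S$ generated by $F_1,\dots,F_n$. The state $(\star,\dots,\star)$ is also denoted by $\star$. **Hecke–Kiselman monoid.** For a finite directed acyclic graph $\Gamma$, $\mathbf{HK}_{\Gamma}$ is the monoid generated by the vertices $a_i$ of $\Gamma$ with relations $a_i^2=a_i$ for all $i$, $a_ia_ja_i=a_ja_ia_j=a_ia_j$ whenever $i\to j$, and $a_ia_j=a_ja_i$ whenever neither $i\to j$ nor $j\to i$. **Theorem.** * (0) For every $w\in W$ the fibre $\pi^{-1}(\pi(w))$ contains exactly one canonical word, denoted by $\operatorname{Can} w$. * (i) For every $w\in W$, if $(p_1,\dots,p_n)=F_w(\star)$, then $\operatorname{Can} w=[p_n,[\dots,[p_2,p_1]\dots]]$. * (ii) For all $u,v\in W$, $F_u=F_v$ if and only if $\operatorname{Can}u=\operatorname{Can}v$.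 * (iii) There is an isomorphism of monoids $\mathrm K_n\to D(\mathcal S_n^\star)$ that sends $a_i$ to $F_i$ for every $i$. * (iv) The evaluation $w\mapsto F_w$ factors through $\mathbf{HK}_{\Gamma_n}$, and it factors through no proper quotient of it: if $c$ is a monoid congruence on $\mathbf{HK}_{\Gamma_n}$ and $w\mapsto F_w$ factors through a monoid homomorphism defined on $\mathbf{HK}_{\Gamma_n}/c$, then $c$ is the equality relation. -/

import Mathlib

namespace KiselmanDynamics

/-! ## Update systems and their dynamics -/

/-- The image of a word under the monoid homomorphism from the free monoid that sends each
letter `a` to `g a`. -/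
def evalWord {α M : Type*} [Monoid M] (g : α → M) (w : List α) : M :=
  (w.map g).prod

/-- An update system on a directed graph: a finite set of states for each vertex, and for each
vertex an update function that depends on the states of its out-neighbours only. -/
structure UpdateSystem {V : Type} (Γ : Digraph V) where
  /-- the set of states of each vertex -/
  State : V → Type
  finite_state : ∀ i, Finite (State i)
  /-- the vertex functions -/
  vertexFun : ∀ i, (∀ j : {j // Γ.Adj i j}, State j) → State i

namespace UpdateSystem

variable {V : Type} [DecidableEq V] {Γ : Digraph V}

/-- The system states. -/
abbrev SystemState (S : UpdateSystem Γ) : Type := ∀ i, S.State i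

/-- The `Γ`-local function at the vertex `i`: it updates the state of `i`, and only this one.
The monoid structure of `Function.End` is composition, `(f * g) s = f (g s)`. -/
def localFun (S : UpdateSystem Γ) (i : V) : Function.End S.SystemState :=
  fun s => Function.update s i (S.vertexFun i fun j => s j)

/-- The evolution `F_w = F_{i₁} ∘ ⋯ ∘ F_{iₖ}` induced by the word `w = i₁ ⋯ iₖ`. -/
def evolution (S : UpdateSystem Γ) (w : List V) : Function.End S.SystemState :=
  evalWord S.localFun w

/-- The dynamics monoid: the monoid of self-maps generated by the local functions. -/
def dynamicsMonoid (S : UpdateSystem Γ) : Submonoid (Function.End S.SystemState) :=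
  Submonoid.closure (Set.range S.localFun)

end UpdateSystem

/-! ## Hecke-Kiselman monoids and Kiselman's semigroups -/

/-- The defining relations of the Hecke-Kiselman monoid of a directed acyclic graph. -/
inductive HeckeKiselmanRel {V : Type} (Γ : Digraph V) : FreeMonoid V → FreeMonoid V → Prop
  | idem (i : V) : HeckeKiselmanRel Γ (.of i * .of i) (.of i)
  | arrow_left (i j : V) : Γ.Adj i j →
      HeckeKiselmanRel Γ (.of i * .of j * .of i) (.of i * .of j)
  | arrow_right (i j : V) : Γ.Adj i j →
      HeckeKiselmanRel Γ (.of j * .of i * .of j) (.of i * .of j)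
  | comm (i j : V) : ¬ Γ.Adj i j → ¬ Γ.Adj j i →
      HeckeKiselmanRel Γ (.of i * .of j) (.of j * .of i)

/-- The Hecke-Kiselman monoid of a directed acyclic graph. -/
abbrev HeckeKiselman {V : Type} (Γ : Digraph V) : Type :=
  PresentedMonoid (HeckeKiselmanRel Γ)

/-- The generators of the Hecke-Kiselman monoid. -/
def HeckeKiselman.gen {V : Type} (Γ : Digraph V) (i : V) : HeckeKiselman Γ :=
  PresentedMonoid.of (HeckeKiselmanRel Γ) i

/-- The complete acyclic oriented graph on `n` vertices: `i → j` if and only if `i < j`. -/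
def completeOriented (n : ℕ) : Digraph (Fin n) where
  Adj i j := i < j

/-- The defining relations of Kiselman's semigroup. -/
inductive KiselmanRel (n : ℕ) : FreeMonoid (Fin n) → FreeMonoid (Fin n) → Prop
  | idem (i : Fin n) : KiselmanRel n (.of i * .of i) (.of i)
  | left (i j : Fin n) : i < j → KiselmanRel n (.of i * .of j * .of i) (.of i * .of j)
  | right (i j : Fin n) : i < j → KiselmanRel n (.of j * .of i * .of j) (.of i * .of j)

/-- Kiselman's semigroup `K_n` (a monoid). -/
abbrev Kiselman (n : ℕ) : Type := PresentedMonoid (KiselmanRel n)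

/-- The generators of Kiselman's semigroup. -/
def Kiselman.gen {n : ℕ} (i : Fin n) : Kiselman n :=
  PresentedMonoid.of (KiselmanRel n) i

/-- The evaluation of words in Kiselman's semigroup. -/
def kiselmanEval {n : ℕ} (w : List (Fin n)) : Kiselman n :=
  evalWord Kiselman.gen w

/-! ## Canonical words -/

/-- A word is canonical if each of its subwords (blocks of consecutive letters) of the form
`a_i u a_i` is special, that is, `u` contains some `a_j` with `j > i` and some `a_k` with
`k < i`. -/
def IsCanonical {n : ℕ} (w : List (Fin n)) : Prop :=
  ∀ (i : Fin n) (u : List (Fin n)), (i :: u ++ [i]) <:+: w →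
    (∃ j ∈ u, i < j) ∧ (∃ k ∈ u, k < i)

theorem kiselmanEval_append {n : ℕ} (u v : List (Fin n)) :
    kiselmanEval (u ++ v) = kiselmanEval u * kiselmanEval v := by
  simp [kiselmanEval, evalWord]

theorem kiselmanEval_cons {n : ℕ} (i : Fin n) (v : List (Fin n)) :
    kiselmanEval (i :: v) = Kiselman.gen i * kiselmanEval v := by
  simp [kiselmanEval, evalWord]

theorem kiselmanEval_nil {n : ℕ} : kiselmanEval ([] : List (Fin n)) = 1 := rfl

theorem Kiselman.gen_mul_self {n : ℕ} (i : Fin n) :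
    Kiselman.gen i * Kiselman.gen i = Kiselman.gen i :=
  PresentedMonoid.mk_eq_mk_of_rel (KiselmanRel.idem i)

theorem Kiselman.gen_left {n : ℕ} {i j : Fin n} (h : i < j) :
    Kiselman.gen i * Kiselman.gen j * Kiselman.gen i = Kiselman.gen i * Kiselman.gen j :=
  PresentedMonoid.mk_eq_mk_of_rel (KiselmanRel.left i j h)

theorem Kiselman.gen_right {n : ℕ} {i j : Fin n} (h : i < j) :
    Kiselman.gen j * Kiselman.gen i * Kiselman.gen j = Kiselman.gen i * Kiselman.gen j :=
  PresentedMonoid.mk_eq_mk_of_rel (KiselmanRel.right i j h)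

theorem kiselmanEval_simp_right {n : ℕ} (i : Fin n) (u : List (Fin n)) (h : ∀ j ∈ u, i ≤ j) :
    Kiselman.gen i * kiselmanEval u * Kiselman.gen i = Kiselman.gen i * kiselmanEval u := by
  induction u with
  | nil => simpa [kiselmanEval_nil] using Kiselman.gen_mul_self i
  | cons x u ih =>
    have ih' := ih fun j hj => h j (List.mem_cons_of_mem _ hj)
    have hx : Kiselman.gen i * Kiselman.gen x * Kiselman.gen i
        = Kiselman.gen i * Kiselman.gen x := by
      rcases (h x List.mem_cons_self).eq_or_lt with rfl | hlt
      · simp [Kiselman.gen_mul_self]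
      · exact Kiselman.gen_left hlt
    rw [kiselmanEval_cons, ← mul_assoc, ← hx, mul_assoc _ (Kiselman.gen i),
      mul_assoc _ _ (Kiselman.gen i), ih']

theorem kiselmanEval_simp_left {n : ℕ} (i : Fin n) (u : List (Fin n)) (h : ∀ j ∈ u, j ≤ i) :
    Kiselman.gen i * kiselmanEval u * Kiselman.gen i = kiselmanEval u * Kiselman.gen i := by
  induction u with
  | nil => simpa [kiselmanEval_nil] using Kiselman.gen_mul_self i
  | cons x u ih =>
    have ih' := ih fun j hj => h j (List.mem_cons_of_mem _ hj)
    have hx : Kiselman.gen i * Kiselman.gen x * Kiselman.gen i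
        = Kiselman.gen x * Kiselman.gen i := by
      rcases (h x List.mem_cons_self).eq_or_lt with rfl | hlt
      · simp [Kiselman.gen_mul_self]
      · exact Kiselman.gen_right hlt
    rw [kiselmanEval_cons, mul_assoc (Kiselman.gen x), ← ih']
    simp only [← mul_assoc]
    rw [← hx]
    simp only [mul_assoc] at ih' ⊢
    rw [ih']

/-- Every fibre of the evaluation in Kiselman's semigroup contains a canonical word. -/
theorem exists_isCanonical {n : ℕ} (w : List (Fin n)) :
    ∃ v : List (Fin n), IsCanonical v ∧ kiselmanEval v = kiselmanEval w := by
  induction hl : w.length using Nat.strong_induction_on generalizing w with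
  | _ l ih =>
    by_cases hw : IsCanonical w
    · exact ⟨w, hw, rfl⟩
    · unfold IsCanonical at hw
      push Not at hw
      obtain ⟨i, u, ⟨s, t, rfl⟩, hu⟩ := hw
      by_cases h : ∃ j ∈ u, i < j
      · have h' : ∀ k ∈ u, i ≤ k := hu h
        obtain ⟨v, hv, he⟩ := ih (s ++ (i :: u) ++ t).length (by subst hl; simp) _ rfl
        refine ⟨v, hv, he.trans ?_⟩
        simp only [kiselmanEval_append, kiselmanEval_cons, kiselmanEval_nil, mul_one]
        rw [kiselmanEval_simp_right i u h']
      · push Not at h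
        obtain ⟨v, hv, he⟩ := ih (s ++ (u ++ [i]) ++ t).length (by subst hl; simp) _ rfl
        refine ⟨v, hv, he.trans ?_⟩
        simp only [kiselmanEval_append, kiselmanEval_cons, kiselmanEval_nil, mul_one]
        rw [kiselmanEval_simp_left i u h]

/-- The canonical form of a word `w`: the canonical word with the same image as `w` in
Kiselman's semigroup. -/
noncomputable def canonicalForm {n : ℕ} (w : List (Fin n)) : List (Fin n) :=
  (exists_isCanonical w).choose

/-! ## The join operation -/

/-- The join `[u, v] = u⁺ v`, where `u = u⁺ u⁻` and `u⁻` is the longest suffix of `u` that is a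
quasi-subword (a not necessarily consecutive ordered substring) of `v`; see `join_spec`. -/
def join {α : Type*} [DecidableEq α] : List α → List α → List α
  | [], v => v
  | a :: u, v => if (a :: u).Sublist v then v else a :: join u v

theorem join_spec {α : Type*} [DecidableEq α] (u v : List α) :
    ∃ p m : List α, u = p ++ m ∧ join u v = p ++ v ∧ m.Sublist v ∧
      ∀ m' : List α, m' <:+ u → m'.Sublist v → m' <:+ m := by
  induction u with
  | nil => exact ⟨[], [], rfl, rfl, List.nil_sublist _, fun m' h _ => h⟩
  | cons a u ih =>
    by_cases h : (a :: u).Sublist v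
    · exact ⟨[], a :: u, rfl, by simp [join, h], h, fun m' h _ => h⟩
    · obtain ⟨p, m, h1, h2, h3, h4⟩ := ih
      refine ⟨a :: p, m, by simp [h1], by simp [join, h, h2], h3, fun m' hm hv => ?_⟩
      rcases List.suffix_cons_iff.1 hm with rfl | hm
      · exact absurd hv h
      · exact h4 m' hm hv

/-- The iterated join `[x_m, [ …, [x_2, x_1] … ]]` of a list `x_1, …, x_m` of words (the empty
word if the list is empty). -/
def iteratedJoin {α : Type*} [DecidableEq α] (l : List (List α)) : List α :=
  l.foldl (fun acc x => join x acc) []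

/-! ## The update system `S_n^⋆` -/

/-- The list `s_{i+1}, …, s_n`. -/
def wordsAbove {n : ℕ} (i : Fin n) (s : ∀ j : Fin n, i < j → List (Fin n)) :
    List (List (Fin n)) :=
  (List.finRange n).filterMap fun j => if h : i < j then some (s j h) else none

/-- `IsStarState i w` means that the word `w` lies in the state set `S_i`, which is
`{⋆} ∪ a_i [S_n, [ …, [S_{i+2}, S_{i+1}] … ]]` (by downward recursion on `i`). -/
inductive IsStarState {n : ℕ} : Fin n → List (Fin n) → Prop
  | empty (i : Fin n) : IsStarState i []
  | cons (i : Fin n) (s : ∀ j : Fin n, i < j → List (Fin n)) :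
      (∀ (j : Fin n) (h : i < j), IsStarState j (s j h)) →
      IsStarState i (i :: iteratedJoin (wordsAbove i s))

theorem finite_isStarState {n : ℕ} (i : Fin n) : Finite {w : List (Fin n) // IsStarState i w} := by
  induction i using WellFoundedGT.induction with
  | _ i ih =>
    have : ∀ j : {j : Fin n // i < j}, Finite {w : List (Fin n) // IsStarState j.1 w} :=
      fun j => ih j.1 j.2
    let g : (∀ j : {j : Fin n // i < j}, {w : List (Fin n) // IsStarState j.1 w}) →
        List (Fin n) := fun s => i :: iteratedJoin (wordsAbove i fun j h => (s ⟨j, h⟩).1)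
    refine Set.Finite.subset ((Set.finite_range g).insert []) ?_
    intro w hw
    cases hw with
    | empty => exact Set.mem_insert _ _
    | cons _ s hs => exact Set.mem_insert_of_mem _ ⟨fun j => ⟨s j.1 j.2, hs j.1 j.2⟩, rfl⟩

/-- The update system `S_n^⋆` on the complete acyclic oriented graph, with vertex functions
`f_i (s_{i+1}, …, s_n) = a_i [s_n, [ …, [s_{i+2}, s_{i+1}] … ]]`. -/
def starSystem (n : ℕ) : UpdateSystem (completeOriented n) where
  State i := {w : List (Fin n) // IsStarState i w}
  finite_state := finite_isStarState
  vertexFun i s :=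
    ⟨i :: iteratedJoin (wordsAbove i fun j h => (s ⟨j, h⟩).1),
      IsStarState.cons i _ fun j h => (s ⟨j, h⟩).2⟩

/-- The system state `⋆ = (⋆, …, ⋆)`. -/
def starState (n : ℕ) : (starSystem n).SystemState :=
  fun i => ⟨[], IsStarState.empty i⟩

end KiselmanDynamics

open KiselmanDynamics

/-! The heart of the matter is a reconstruction: a canonical word v is the iterated join of the
entries of F_v(⋆). Since the local updates satisfy Kiselman's relations (`evalWord_updateAt_congr`),
these entries depend only on the class of v. Hence a fibre contains at most one canonical word
(`exists_isCanonical` supplies one), and the evolutions, already through their values at ⋆, separate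
the elements of K_n. As the Hecke-Kiselman monoid of the complete graph is K_n, statement (iv) is
this faithfulness again.

The reconstruction (`IsCanonical.iteratedJoin_starWord_prefix`) is an induction on length. Write v =
a_i z P, where P begins at the first letter smaller than a_i. The vertices below i contribute P. The
entry at i sees only the letters of z P above a_i, so it is a_i followed by the canonical form of
that filtered word, which is z Q for some subsequence Q of P
(`LeftReduced.exists_isCanonical_append`). Joining a_i z Q to P gives back v as soon as c Q is not a
subsequence of P, where c is the last letter of a_i z.

This last fact (`IsCanonical.not_cons_sublist`) is detected by a second, numerical action s_i := 1 +
∑_{j>i} s_j. Left reducedness makes every letter strictly increase its entry, and right reducedness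
carries a strict inequality through a_i z; an embedding of c Q would contradict the resulting
inequality at i. -/

namespace KiselmanDynamics

/-! ## Reduced words -/

/-- Every block `a_i u a_i` of the word contains a letter greater than `a_i`. -/
def LeftReduced {n : ℕ} (w : List (Fin n)) : Prop :=
  ∀ (i : Fin n) (u : List (Fin n)), (i :: u ++ [i]) <:+: w → ∃ j ∈ u, i < j

/-- Every block `a_i u a_i` of the word contains a letter smaller than `a_i`. -/
def RightReduced {n : ℕ} (w : List (Fin n)) : Prop :=
  ∀ (i : Fin n) (u : List (Fin n)), (i :: u ++ [i]) <:+: w → ∃ k ∈ u, k < i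

theorem LeftReduced.infix {n : ℕ} {v w : List (Fin n)} (h : LeftReduced w) (hv : v <:+: w) :
    LeftReduced v := fun i u hu => h i u (hu.trans hv)

theorem RightReduced.infix {n : ℕ} {v w : List (Fin n)} (h : RightReduced w) (hv : v <:+: w) :
    RightReduced v := fun i u hu => h i u (hu.trans hv)

theorem isCanonical_iff {n : ℕ} {w : List (Fin n)} :
    IsCanonical w ↔ LeftReduced w ∧ RightReduced w :=
  ⟨fun h => ⟨fun i u hu => (h i u hu).1, fun i u hu => (h i u hu).2⟩,
    fun h i u hu => ⟨h.1 i u hu, h.2 i u hu⟩⟩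

theorem IsCanonical.infix {n : ℕ} {v w : List (Fin n)} (h : IsCanonical w) (hv : v <:+: w) :
    IsCanonical v := fun i u hu => h i u (hu.trans hv)

theorem exists_of_filter_eq_append_cons {α : Type*} {p : α → Bool} {a : α} {w x y : List α}
    (h : w.filter p = x ++ a :: y) :
    ∃ x' y', w = x' ++ a :: y' ∧ x'.filter p = x ∧ y'.filter p = y := by
  obtain ⟨w₁, w₂, rfl, rfl, h₂⟩ := List.filter_eq_append_iff.1 h
  obtain ⟨l₁, l₂, rfl, h₃, -, rfl⟩ := List.filter_eq_cons_iff.1 h₂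
  refine ⟨w₁ ++ l₁, l₂, by simp, ?_, rfl⟩
  rw [List.filter_append, List.filter_eq_nil_iff.2 h₃, List.append_nil]

/-- A witness greater than a surviving letter survives the filter as well. Right reducedness has no
such inheritance, which is why further letters may have to be deleted after filtering. -/
theorem LeftReduced.filter_lt {n : ℕ} {w : List (Fin n)} (h : LeftReduced w) (i : Fin n) :
    LeftReduced (w.filter (i < ·)) := by
  rintro g u ⟨s, t, hst⟩
  obtain ⟨x, y, rfl, -, hy⟩ := exists_of_filter_eq_append_cons
    (show w.filter (i < ·) = s ++ g :: (u ++ [g] ++ t) by simp [← hst])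
  obtain ⟨x', y', rfl, hx', -⟩ := exists_of_filter_eq_append_cons
    (show y.filter (i < ·) = u ++ g :: t by simp [hy])
  obtain ⟨j, hj, hgj⟩ := h g x' ⟨x, y', by simp⟩
  have hg : i < g := by
    have : g ∈ (x ++ g :: (x' ++ g :: y')).filter (i < ·) := by rw [← hst]; simp
    simpa using (List.mem_filter.1 this).2
  exact ⟨j, hx' ▸ List.mem_filter.2 ⟨hj, by simpa using hg.trans hgj⟩, hgj⟩

/-- Deleting the second letter of a block `a_f u a_f` without letters smaller than `a_f`
preserves left reducedness. -/
theorem LeftReduced.delete {n : ℕ} {s u t : List (Fin n)} {f : Fin n}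
    (h : LeftReduced (s ++ f :: u ++ f :: t)) (hu : ∀ k ∈ u, f ≤ k) :
    LeftReduced (s ++ f :: u ++ t) := by
  rintro g v ⟨s', t', hst⟩
  have hst' : (s' ++ g :: v) ++ (g :: t') = (s ++ f :: u) ++ t := by simpa using hst
  rcases List.append_eq_append_iff.1 hst' with ⟨a, ha, hb⟩ | ⟨c, hc, ht⟩
  · cases a with
    | nil =>
      simp only [List.nil_append] at hb
      subst hb
      simp only [List.append_nil] at ha
      obtain ⟨j, hj, hgj⟩ := h g (v ++ [f]) ⟨s', t', by rw [ha]; simp⟩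
      rcases List.mem_append.1 hj with hj | hj
      · exact ⟨j, hj, hgj⟩
      -- The only witness may be the deleted letter `f`. Then `g < f`, while `f :: u` has no letter
      -- below `f`; so the block starts before the retained `f`, which serves as the witness.
      · obtain rfl : j = f := by simpa using hj
        rcases List.suffix_or_suffix_of_suffix (⟨s, ha⟩ : j :: u <:+ s' ++ g :: v)
          ⟨s', rfl⟩ with h1 | h1
        · have : j ∈ g :: v := h1.subset (by simp)
          rcases List.mem_cons.1 this with rfl | h2
          · exact absurd hgj (lt_irrefl _)
          · exact ⟨j, h2, hgj⟩
        · have : g ∈ j :: u := h1.subset (by simp)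
          rcases List.mem_cons.1 this with rfl | h2
          · exact absurd hgj (lt_irrefl _)
          · exact absurd hgj (not_lt.2 (hu g h2))
    | cons b a =>
      obtain ⟨rfl, rfl⟩ : g = b ∧ t' = a ++ t := by simpa using hb
      exact h g v ⟨s', a ++ f :: t, by rw [ha]; simp⟩
  · rcases List.append_eq_append_iff.1 hc with ⟨a, ha, hb⟩ | ⟨d, hd, he⟩
    · cases a with
      | nil =>
        simp only [List.nil_append] at hb
        subst hb
        exact h g v ⟨s ++ f :: u ++ [f], t', by rw [ht]; simp⟩
      | cons b a =>
        obtain ⟨rfl, rfl⟩ : g = b ∧ v = a ++ c := by simpa using hb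
        obtain ⟨j, hj, hgj⟩ := h g (a ++ f :: c) ⟨s', t', by rw [ha, ht]; simp⟩
        have hj' : j ∈ a ∨ j = f ∨ j ∈ c := by simpa using hj
        rcases hj' with hj | rfl | hj
        · exact ⟨j, by simp [hj], hgj⟩
        · rcases List.suffix_or_suffix_of_suffix (⟨s, ha⟩ : j :: u <:+ s' ++ g :: a)
            ⟨s', rfl⟩ with h1 | h1
          · have : j ∈ g :: a := h1.subset (by simp)
            rcases List.mem_cons.1 this with rfl | h2
            · exact absurd hgj (lt_irrefl _)
            · exact ⟨j, by simp [h2], hgj⟩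
          · have : g ∈ j :: u := h1.subset (by simp)
            rcases List.mem_cons.1 this with rfl | h2
            · exact absurd hgj (lt_irrefl _)
            · exact absurd hgj (not_lt.2 (hu g h2))
        · exact ⟨j, by simp [hj], hgj⟩
    · exact h g v ⟨s ++ f :: u ++ f :: d, t', by rw [ht, he]; simp⟩

/-- A left reduced word with a right reduced prefix `z` has a canonical form that is obtained by
deleting letters outside of `z`. -/
theorem LeftReduced.exists_isCanonical_append {n : ℕ} (z P : List (Fin n))
    (h : LeftReduced (z ++ P)) (hz : RightReduced z) :
    ∃ Q : List (Fin n), Q.Sublist P ∧ IsCanonical (z ++ Q) ∧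
      kiselmanEval (z ++ Q) = kiselmanEval (z ++ P) := by
  induction hl : P.length using Nat.strong_induction_on generalizing P with
  | _ l ih =>
    by_cases hr : RightReduced (z ++ P)
    · exact ⟨P, List.Sublist.refl _, isCanonical_iff.2 ⟨h, hr⟩, rfl⟩
    unfold RightReduced at hr
    push Not at hr
    obtain ⟨f, u, ⟨s, t, hst⟩, hu⟩ := hr
    have hst' : (s ++ f :: u) ++ f :: t = z ++ P := by simpa using hst
    -- The letter to delete lies outside `z`: otherwise the whole offending block would lie in the
    -- right reduced word `z`.
    obtain ⟨c, hc, rfl⟩ : ∃ c, s ++ f :: u = z ++ c ∧ P = c ++ f :: t := by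
      rcases List.append_eq_append_iff.1 hst' with ⟨a, ha, hb⟩ | ⟨c, hc, hd⟩
      · cases a with
        | nil => exact ⟨[], by simpa using ha.symm, by simpa using hb.symm⟩
        | cons b a =>
          obtain ⟨rfl, -⟩ : f = b ∧ t = a ++ P := by simpa using hb
          obtain ⟨k, hk, hkf⟩ := hz f u ⟨s, a, by rw [ha]; simp⟩
          exact absurd hkf (not_lt.2 (hu k hk))
      · exact ⟨c, hc, hd⟩
    have h1 : LeftReduced (z ++ (c ++ t)) := by
      rw [← List.append_assoc, ← hc]
      rw [← hst'] at h
      exact h.delete hu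
    obtain ⟨Q, hQ, hcan, he⟩ := ih (c ++ t).length (by subst hl; simp) (c ++ t) h1 rfl
    refine ⟨Q, hQ.trans (by simp), hcan, he.trans ?_⟩
    rw [← List.append_assoc, ← hst', ← hc]
    simp only [kiselmanEval_append, kiselmanEval_cons]
    rw [← mul_assoc _ (Kiselman.gen f) (kiselmanEval t), mul_assoc _ _ (Kiselman.gen f),
      kiselmanEval_simp_right f u hu]

/-! ## Local updates -/

/-- The map that updates the entry at `i` of a family, and only this one, by means of `f i`. -/
def updateAt {V : Type*} [DecidableEq V] {α : V → Type*} (f : ∀ i, (∀ j, α j) → α i) (i : V) :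
    Function.End (∀ j, α j) :=
  fun s => Function.update s i (f i s)

/-- The value of `f i` depends only on the entries at the indices greater than `i`. -/
def DependsAbove {V : Type*} [LT V] {α : V → Type*} (f : ∀ i, (∀ j, α j) → α i) : Prop :=
  ∀ i s t, (∀ j, i < j → s j = t j) → f i s = f i t

section updateAt

variable {V : Type*} [LinearOrder V] {α : V → Type*} {f : ∀ i, (∀ j, α j) → α i}

theorem updateAt_self (s : ∀ j, α j) (i : V) : updateAt f i s i = f i s := by simp [updateAt]

theorem updateAt_of_ne (s : ∀ j, α j) {i j : V} (h : j ≠ i) : updateAt f i s j = s j := by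
  simp [updateAt, h]

theorem evalWord_updateAt_cons (i : V) (w : List V) (s : ∀ j, α j) :
    evalWord (updateAt f) (i :: w) s = updateAt f i (evalWord (updateAt f) w s) := by
  simp only [evalWord, List.map_cons, List.prod_cons]; rfl

theorem evalWord_updateAt_append (u v : List V) (s : ∀ j, α j) :
    evalWord (updateAt f) (u ++ v) s = evalWord (updateAt f) u (evalWord (updateAt f) v s) := by
  simp only [evalWord, List.map_append, List.prod_append]; rfl

theorem evalWord_updateAt_of_notMem (w : List V) (s : ∀ j, α j) {i : V} (h : i ∉ w) :
    evalWord (updateAt f) w s i = s i := by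
  induction w with
  | nil => rfl
  | cons a w ih =>
    simp only [List.mem_cons, not_or] at h
    rw [evalWord_updateAt_cons, updateAt_of_ne _ h.1, ih h.2]

/-- Entries above `i` neither read nor are changed by the updates at vertices up to `i`. -/
theorem evalWord_updateAt_filter_lt (hf : DependsAbove f) (w : List V) (s : ∀ j, α j) (i : V) :
    ∀ j, i < j → evalWord (updateAt f) (w.filter (i < ·)) s j = evalWord (updateAt f) w s j := by
  induction w with
  | nil => intro j _; rfl
  | cons a w ih =>
    intro j hj
    by_cases ha : i < a
    · rw [List.filter_cons_of_pos (by simpa using ha), evalWord_updateAt_cons,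
        evalWord_updateAt_cons]
      by_cases hja : j = a
      · subst hja
        rw [updateAt_self, updateAt_self]
        exact hf _ _ _ fun k hk => ih k (hj.trans hk)
      · rw [updateAt_of_ne _ hja, updateAt_of_ne _ hja, ih j hj]
    · rw [List.filter_cons_of_neg (by simpa using ha), evalWord_updateAt_cons,
        updateAt_of_ne _ (by rintro rfl; exact ha hj), ih j hj]

theorem updateAt_mul_self (hf : DependsAbove f) (i : V) :
    updateAt f i * updateAt f i = updateAt f i := by
  funext s
  change updateAt f i (updateAt f i s) = updateAt f i s
  funext k
  by_cases hk : k = i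
  · subst hk
    rw [updateAt_self, updateAt_self]
    exact hf _ _ _ fun j hj => updateAt_of_ne _ hj.ne'
  · rw [updateAt_of_ne _ hk]

/-- The first update at `i` changes an entry that neither later update reads, and the second one
overwrites it. -/
theorem updateAt_left (hf : DependsAbove f) {i j : V} (h : i < j) :
    updateAt f i * updateAt f j * updateAt f i = updateAt f i * updateAt f j := by
  have key : ∀ s, ∀ k, k ≠ i →
      updateAt f j (updateAt f i s) k = updateAt f j s k := by
    intro s k hk
    by_cases hkj : k = j
    · subst hkj
      rw [updateAt_self, updateAt_self]
      exact hf _ _ _ fun l hl => updateAt_of_ne _ (h.trans hl).ne'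
    · rw [updateAt_of_ne _ hkj, updateAt_of_ne _ hkj, updateAt_of_ne _ hk]
  funext s
  change updateAt f i (updateAt f j (updateAt f i s)) = updateAt f i (updateAt f j s)
  funext k
  by_cases hk : k = i
  · subst hk
    rw [updateAt_self, updateAt_self]
    exact hf _ _ _ fun l hl => key s l hl.ne'
  · rw [updateAt_of_ne _ hk, updateAt_of_ne _ hk, key s k hk]

theorem updateAt_right (hf : DependsAbove f) {i j : V} (h : i < j) :
    updateAt f j * updateAt f i * updateAt f j = updateAt f i * updateAt f j := by
  funext s
  change updateAt f j (updateAt f i (updateAt f j s)) = updateAt f i (updateAt f j s)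
  funext k
  by_cases hk : k = j
  · subst hk
    rw [updateAt_self, updateAt_of_ne _ h.ne', updateAt_self]
    refine hf _ _ _ fun l hl => ?_
    rw [updateAt_of_ne _ (h.trans hl).ne', updateAt_of_ne _ hl.ne']
  · rw [updateAt_of_ne _ hk]

end updateAt

/-! ## Monoid homomorphisms from Kiselman's semigroup -/

theorem lift_evalWord {α M : Type*} [Monoid M] (g : α → M) (w : List α) :
    FreeMonoid.lift g (FreeMonoid.ofList w) = evalWord g w := by
  simp [evalWord, FreeMonoid.lift_ofList]

/-- The action of Kiselman's semigroup by local updates. -/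
def kiselmanAction {n : ℕ} {α : Fin n → Type*} (f : ∀ i, (∀ j, α j) → α i)
    (hf : DependsAbove f) : Kiselman n →* Function.End (∀ j, α j) :=
  PresentedMonoid.lift (updateAt f) fun a b h => by
    cases h with
    | idem i => simpa using updateAt_mul_self hf i
    | left i j h => simpa using updateAt_left hf h
    | right i j h => simpa using updateAt_right hf h

theorem kiselmanAction_gen {n : ℕ} {α : Fin n → Type*} (f : ∀ i, (∀ j, α j) → α i)
    (hf : DependsAbove f) (i : Fin n) :
    kiselmanAction f hf (Kiselman.gen i) = updateAt f i := by
  simp [kiselmanAction, Kiselman.gen]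

theorem map_evalWord {α M N : Type*} [Monoid M] [Monoid N] (φ : M →* N) (g : α → M)
    (w : List α) : φ (evalWord g w) = evalWord (φ ∘ g) w := by
  simp [evalWord, map_list_prod]

theorem kiselmanAction_eval {n : ℕ} {α : Fin n → Type*} (f : ∀ i, (∀ j, α j) → α i)
    (hf : DependsAbove f) (w : List (Fin n)) :
    kiselmanAction f hf (kiselmanEval w) = evalWord (updateAt f) w := by
  rw [kiselmanEval, map_evalWord]
  congr 1

theorem evalWord_updateAt_congr {n : ℕ} {α : Fin n → Type*} {f : ∀ i, (∀ j, α j) → α i}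
    (hf : DependsAbove f) {u v : List (Fin n)} (h : kiselmanEval u = kiselmanEval v) :
    evalWord (updateAt f) u = evalWord (updateAt f) v := by
  rw [← kiselmanAction_eval f hf, h, kiselmanAction_eval]

end KiselmanDynamics
namespace KiselmanDynamics

/-! ## A monotone numerical action -/

/-- The vertex functions `s ↦ 1 + ∑_{j > i} s_j` with values in the natural numbers. -/
def sumAbove {n : ℕ} (i : Fin n) (s : Fin n → ℕ) : ℕ :=
  1 + ∑ j ∈ Finset.Ioi i, s j

theorem dependsAbove_sumAbove {n : ℕ} :
    DependsAbove (α := fun _ : Fin n => ℕ) sumAbove := by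
  intro i s t h
  unfold sumAbove
  rw [Finset.sum_congr rfl fun j hj => h j (Finset.mem_Ioi.1 hj)]

theorem sumAbove_mono {n : ℕ} (i : Fin n) {s t : Fin n → ℕ} (h : s ≤ t) :
    sumAbove i s ≤ sumAbove i t :=
  Nat.add_le_add_left (Finset.sum_le_sum fun j _ => h j) 1

theorem sumAbove_lt {n : ℕ} {i j : Fin n} {s t : Fin n → ℕ} (h : s ≤ t) (hij : i < j)
    (hj : s j < t j) : sumAbove i s < sumAbove i t :=
  Nat.add_lt_add_left
    (Finset.sum_lt_sum (fun j _ => h j) ⟨j, Finset.mem_Ioi.2 hij, hj⟩) 1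

/-- The action of words on numerical states. -/
def numAct {n : ℕ} (w : List (Fin n)) : Function.End (Fin n → ℕ) :=
  evalWord (updateAt (α := fun _ : Fin n => ℕ) sumAbove) w

section numAct

variable {n : ℕ}

theorem numAct_cons_self (i : Fin n) (w : List (Fin n)) (s : Fin n → ℕ) :
    numAct (i :: w) s i = sumAbove i (numAct w s) := by
  unfold numAct
  rw [evalWord_updateAt_cons, updateAt_self]

theorem numAct_cons_of_ne {i j : Fin n} (h : j ≠ i) (w : List (Fin n)) (s : Fin n → ℕ) :
    numAct (i :: w) s j = numAct w s j := by
  unfold numAct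
  rw [evalWord_updateAt_cons, updateAt_of_ne _ h]

theorem numAct_append (u v : List (Fin n)) (s : Fin n → ℕ) :
    numAct (u ++ v) s = numAct u (numAct v s) :=
  evalWord_updateAt_append u v s

theorem numAct_of_notMem {i : Fin n} {w : List (Fin n)} (h : i ∉ w) (s : Fin n → ℕ) :
    numAct w s i = s i :=
  evalWord_updateAt_of_notMem w s h

theorem numAct_mono (w : List (Fin n)) {s t : Fin n → ℕ} (h : s ≤ t) :
    numAct w s ≤ numAct w t := by
  induction w with
  | nil => exact h
  | cons i w ih =>
    intro j
    by_cases hj : j = i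
    · subst hj
      rw [numAct_cons_self, numAct_cons_self]
      exact sumAbove_mono _ ih
    · rw [numAct_cons_of_ne hj, numAct_cons_of_ne hj]
      exact ih j

/-- Starting from zero, no update ever decreases an entry. The two claims support each other: growth
under one letter, with monotonicity of `sumAbove`, keeps the stored values below the recomputed
ones. -/
theorem numAct_zero_le_sumAbove (w : List (Fin n)) (i : Fin n) :
    numAct w 0 i ≤ sumAbove i (numAct w 0) ∧ numAct w 0 ≤ numAct (i :: w) 0 := by
  have key : ∀ v : List (Fin n), (∀ i, numAct v 0 i ≤ sumAbove i (numAct v 0)) →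
      ∀ i, numAct v 0 ≤ numAct (i :: v) 0 := by
    intro v hv i j
    by_cases hj : j = i
    · subst hj
      rw [numAct_cons_self]
      exact hv j
    · rw [numAct_cons_of_ne hj]
  have h : ∀ i, numAct w 0 i ≤ sumAbove i (numAct w 0) := by
    induction w with
    | nil => intro i; exact Nat.zero_le _
    | cons a w ih =>
      intro i
      refine le_trans ?_ (sumAbove_mono i (key w ih a))
      by_cases hi : i = a
      · subst hi
        rw [numAct_cons_self]
      · rw [numAct_cons_of_ne hi]
        exact ih i
  exact ⟨h i, key w h i⟩

theorem numAct_zero_le_append (u v : List (Fin n)) : numAct v 0 ≤ numAct (u ++ v) 0 := by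
  induction u with
  | nil => exact le_rfl
  | cons a u ih => exact ih.trans (numAct_zero_le_sumAbove _ a).2

theorem numAct_zero_le_of_sublist {u v : List (Fin n)} (h : u.Sublist v) :
    numAct u 0 ≤ numAct v 0 := by
  induction h with
  | slnil => exact le_rfl
  | cons a _ ih => exact ih.trans (numAct_zero_le_sumAbove _ a).2
  | cons_cons a _ ih => exact numAct_mono [a] ih

/-- Each letter of a left reduced word strictly increases the entry that it updates. -/
theorem LeftReduced.numAct_lt (x y : List (Fin n)) (h : LeftReduced (x ++ y)) :
    ∀ e ∈ x, numAct y 0 e < numAct (x ++ y) 0 e := by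
  induction hl : (x ++ y).length using Nat.strong_induction_on generalizing x y with
  | _ l ih =>
    cases x with
    | nil => intro e he; cases he
    | cons a x =>
      have hr : LeftReduced (x ++ y) := h.infix ⟨[a], [], by simp⟩
      have hstep : numAct (x ++ y) 0 a < numAct (a :: (x ++ y)) 0 a := by
        rw [numAct_cons_self]
        by_cases ha : a ∈ x ++ y
        · obtain ⟨x₁, y₁, hxy, hax⟩ := List.eq_append_cons_of_mem ha
          rw [List.cons_append] at h
          rw [hxy] at h hr ⊢
          -- Since the previous update at `a`, some entry `e > a` has been updated, and by induction
          -- it has strictly grown; hence the recomputed sum is strictly larger.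
          obtain ⟨e, he, hae⟩ := h a x₁ ⟨[], y₁, by simp⟩
          rw [numAct_append, numAct_of_notMem hax, numAct_cons_self, ← numAct_append]
          refine sumAbove_lt (numAct_zero_le_of_sublist (by simp)) hae ?_
          exact lt_of_le_of_lt ((numAct_zero_le_sumAbove y₁ a).2 e)
            (ih (x₁ ++ a :: y₁).length (by subst hl; simp [← hxy]) x₁ (a :: y₁) hr rfl e he)
        -- At the first update of `a` its entry is still 0, and the summand 1 in `sumAbove` makes
        -- the new value positive.
        · rw [numAct_of_notMem ha]
          unfold sumAbove
          simp
      intro e he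
      rcases List.mem_cons.1 he with rfl | he
      · exact lt_of_le_of_lt (numAct_zero_le_append x y e) hstep
      · exact lt_of_lt_of_le (ih (x ++ y).length (by subst hl; simp) x y hr rfl e he)
          ((numAct_zero_le_sumAbove _ a).2 e)

/-- A right reduced word does not erase a difference of two states at its last letter and at a
greater letter. -/
theorem RightReduced.numAct_lt {s t : Fin n → ℕ} (hst : s ≤ t) {c d : Fin n} (hcd : c < d)
    (hd : s d < t d) (z : List (Fin n)) (hz : RightReduced (z ++ [c])) (f : Fin n)
    (hf : f ∈ z ++ [c]) (hmin : ∀ g ∈ z ++ [c], f ≤ g) :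
    numAct (z ++ [c]) s f < numAct (z ++ [c]) t f := by
  induction z generalizing f with
  | nil =>
    obtain rfl : f = c := by simpa using hf
    change numAct [f] s f < numAct [f] t f
    rw [numAct_cons_self, numAct_cons_self]
    exact sumAbove_lt hst hcd hd
  | cons a z ih =>
    have hz' : RightReduced (z ++ [c]) := hz.infix ⟨[a], [], by simp⟩
    rw [List.cons_append] at *
    by_cases ha : f = a
    · subst ha
      -- A second occurrence of the minimal letter `f` would give a block without a smaller letter.
      -- So the minimum `g` of the rest exceeds `f`, and the difference at `g` passes to the sum at
      -- `f`.
      have hnot : f ∉ z ++ [c] := by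
        intro hmem
        obtain ⟨x, y, hxy, -⟩ := List.eq_append_cons_of_mem hmem
        obtain ⟨k, hk, hkf⟩ := hz f x ⟨[], y, by rw [hxy]; simp⟩
        exact absurd hkf (not_lt.2 (hmin k (by rw [hxy]; simp [hk])))
      obtain ⟨g, hg, hgmin⟩ := (z ++ [c]).toFinset.exists_min_image id ⟨c, by simp⟩
      have hg' : g ∈ z ++ [c] := List.mem_toFinset.1 hg
      have hfg : f < g := lt_of_le_of_ne (hmin g (List.mem_cons_of_mem _ hg'))
        (by rintro rfl; exact hnot hg')
      rw [numAct_cons_self, numAct_cons_self]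
      exact sumAbove_lt (numAct_mono _ hst) hfg
        (ih hz' g hg' fun k hk => hgmin k (List.mem_toFinset.2 hk))
    · rw [numAct_cons_of_ne ha, numAct_cons_of_ne ha]
      exact ih hz' f ((List.mem_cons.1 hf).resolve_left ha)
        fun g hg => hmin g (List.mem_cons_of_mem _ hg)

theorem exists_of_cons_sublist {α : Type*} [DecidableEq α] {c : α} {Q P : List α}
    (h : (c :: Q).Sublist P) : ∃ x y, P = x ++ c :: y ∧ Q.Sublist y := by
  induction P with
  | nil => cases h
  | cons b P ih =>
    cases h with
    | cons _ h =>
      obtain ⟨x, y, rfl, hy⟩ := ih h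
      exact ⟨b :: x, y, rfl, hy⟩
    | cons_cons _ h => exact ⟨[], P, rfl, h⟩

/-- If `a_i z P` is canonical, all letters of `z` are greater than `a_i`, and `z Q` equals in
Kiselman's semigroup the word that is obtained from `z P` by deleting the letters up to `a_i`,
then the last letter `c` of `a_i z` is such that `c Q` is not a quasi-subword of `P`. -/
theorem IsCanonical.not_cons_sublist {i c : Fin n} {z z' P Q : List (Fin n)}
    (h : IsCanonical (i :: z ++ P)) (hz : ∀ g ∈ z, i < g) (hc : i :: z = z' ++ [c])
    (hQ : kiselmanEval (z ++ Q) = kiselmanEval ((z ++ P).filter (i < ·))) :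
    ¬ (c :: Q).Sublist P := by
  intro hsub
  obtain ⟨x, y, rfl, hy⟩ := exists_of_cons_sublist hsub
  have hic : ∀ g ∈ z' ++ [c], i ≤ g := by
    rw [← hc]
    intro g hg
    rcases List.mem_cons.1 hg with rfl | hg
    · exact le_rfl
    · exact (hz g hg).le
  have hlr := (isCanonical_iff.1 h).1
  have hrr := (isCanonical_iff.1 h).2
  -- The block from the last letter `c` of `i :: z` to the `c` found in `P` is `c x c`. Its letter
  -- `d > c` makes the states after `y` and after `x c y` differ at `d`, and `i :: z` carries this
  -- difference to the entry at `i`.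
  obtain ⟨d, hd, hcd⟩ := hlr c x ⟨z', y, by rw [hc]; simp⟩
  have hlr' : LeftReduced ((x ++ [c]) ++ y) := hlr.infix ⟨i :: z, [], by simp⟩
  have hdlt := hlr'.numAct_lt (x ++ [c]) y d (by simp [hd])
  have hlt := RightReduced.numAct_lt (numAct_zero_le_append (x ++ [c]) y) hcd hdlt z'
    (hrr.infix ⟨[], x ++ c :: y, by rw [← hc]; simp⟩) i (by rw [← hc]; simp) hic
  rw [← hc, ← numAct_append, ← numAct_append, List.cons_append, List.cons_append,
    numAct_cons_self, numAct_cons_self] at hlt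
  -- Conversely, `z Q` acts above `i` exactly as `z P`, whereas `Q` embeds into `y`; so the value
  -- for `z P` cannot exceed that for `z y`.
  have hle : sumAbove i (numAct (z ++ Q) 0) ≤ sumAbove i (numAct (z ++ y) 0) :=
    sumAbove_mono i (numAct_zero_le_of_sublist (hy.append_left z))
  have heq : numAct (z ++ Q) = numAct ((z ++ (x ++ c :: y)).filter (i < ·)) :=
    evalWord_updateAt_congr dependsAbove_sumAbove hQ
  have heq' : sumAbove i (numAct (z ++ Q) 0) = sumAbove i (numAct (z ++ (x ++ c :: y)) 0) := by
    rw [heq]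
    exact dependsAbove_sumAbove i _ _ fun j hj =>
      evalWord_updateAt_filter_lt dependsAbove_sumAbove _ _ i j hj
  rw [heq'] at hle
  simp only [List.append_assoc, List.singleton_append] at hlt
  exact absurd hlt (not_lt.2 hle)

end numAct

/-! ## Joins -/

section join

variable {α : Type*} [DecidableEq α]

theorem join_of_sublist {u v : List α} (h : u.Sublist v) : join u v = v := by
  cases u with
  | nil => rfl
  | cons a u => simp [join, h]

/-- Every suffix longer than `Q` contains `c :: Q` as a subsequence, so `Q` is the longest suffix
that embeds into `P`. -/
theorem join_append_cons {A Q P : List α} {c : α} (hQ : Q.Sublist P)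
    (hc : ¬ (c :: Q).Sublist P) : join (A ++ c :: Q) P = A ++ c :: P := by
  induction A with
  | nil => simp [join, hc, join_of_sublist hQ]
  | cons a A ih =>
    have : ¬ (a :: (A ++ c :: Q)).Sublist P :=
      fun h => hc (((List.sublist_append_right A _).trans (List.sublist_cons_self a _)).trans h)
    simp [join, this, ih]

theorem sublist_join_left (u v : List α) : u.Sublist (join u v) := by
  obtain ⟨p, m, rfl, h, hm, -⟩ := join_spec u v
  rw [h]
  exact hm.append_left p

theorem sublist_join_right (u v : List α) : v.Sublist (join u v) := by
  obtain ⟨p, m, -, h, -, -⟩ := join_spec u v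
  rw [h]
  exact List.sublist_append_right p v

theorem iteratedJoin_append_cons (l₁ l₂ : List (List α)) (x : List α) :
    iteratedJoin (l₁ ++ x :: l₂) =
      l₂.foldl (fun acc y => join y acc) (join x (iteratedJoin l₁)) := by
  simp [iteratedJoin]

theorem foldl_join_of_sublist {l : List (List α)} {v : List α} (h : ∀ x ∈ l, x.Sublist v) :
    l.foldl (fun acc y => join y acc) v = v := by
  induction l with
  | nil => rfl
  | cons x l ih =>
    rw [List.foldl_cons, join_of_sublist (h x (by simp))]
    exact ih fun y hy => h y (by simp [hy])

theorem sublist_foldl_join (l : List (List α)) (v : List α) :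
    v.Sublist (l.foldl (fun acc y => join y acc) v) := by
  induction l generalizing v with
  | nil => exact List.Sublist.refl _
  | cons x l ih => exact (sublist_join_right x v).trans (ih _)

theorem sublist_iteratedJoin {l : List (List α)} {x : List α} (h : x ∈ l) :
    x.Sublist (iteratedJoin l) := by
  obtain ⟨l₁, l₂, rfl⟩ := List.append_of_mem h
  rw [iteratedJoin_append_cons]
  exact (sublist_join_left x _).trans (sublist_foldl_join l₂ _)

theorem iteratedJoin_of_forall_nil {l : List (List α)} (h : ∀ x ∈ l, x = []) :
    iteratedJoin l = [] :=
  foldl_join_of_sublist fun x hx => by rw [h x hx]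

theorem iteratedJoin_append_of_forall_nil {l₁ : List (List α)} (l₂ : List (List α))
    (h : ∀ x ∈ l₁, x = []) : iteratedJoin (l₁ ++ l₂) = iteratedJoin l₂ := by
  have := iteratedJoin_of_forall_nil h
  unfold iteratedJoin at *
  rw [List.foldl_append, this]

end join

/-! ## The states of the update system -/

section starSystem

variable {n : ℕ}

theorem finRange_split {i : Fin n} {l₁ l₂ : List (Fin n)}
    (h : List.finRange n = l₁ ++ i :: l₂) :
    (∀ a ∈ l₁, a < i) ∧ (∀ b ∈ l₂, i < b) := by
  have hp := List.pairwise_lt_finRange n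
  rw [h, List.pairwise_append, List.pairwise_cons] at hp
  exact ⟨fun a ha => hp.2.2 a ha i (by simp), fun b hb => hp.2.1.1 b hb⟩

theorem wordsAbove_eq_map {i : Fin n} {l₁ l₂ : List (Fin n)}
    (h : List.finRange n = l₁ ++ i :: l₂) (s : Fin n → List (Fin n)) :
    wordsAbove i (fun j _ => s j) = l₂.map s := by
  obtain ⟨h₁, h₂⟩ := finRange_split h
  unfold wordsAbove
  rw [h, List.filterMap_append, List.filterMap_cons]
  have e₁ : l₁.filterMap (fun j => if i < j then some (s j) else none) = [] :=
    List.filterMap_eq_nil_iff.2 fun a ha => by simp [(h₁ a ha).le]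
  have e₂ : l₂.filterMap (fun j => if i < j then some (s j) else none) = l₂.map s := by
    rw [← List.filterMap_eq_map]
    exact List.filterMap_congr fun b hb => by simp [h₂ b hb]
  simp [e₁, e₂]

/-! ### Evolution of the state ⋆ -/

theorem dependsAbove_vertexFun (S : UpdateSystem (completeOriented n)) :
    DependsAbove (fun i (s : S.SystemState) => S.vertexFun i fun j => s j) := by
  intro i s t h
  exact congrArg (S.vertexFun i) (funext fun j => h j j.2)

theorem evolution_eq (S : UpdateSystem (completeOriented n)) (w : List (Fin n)) :
    S.evolution w = evalWord (updateAt fun i (s : S.SystemState) => S.vertexFun i fun j => s j) w :=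
  rfl

theorem evolution_congr (S : UpdateSystem (completeOriented n)) {u v : List (Fin n)}
    (h : kiselmanEval u = kiselmanEval v) : S.evolution u = S.evolution v :=
  evalWord_updateAt_congr (dependsAbove_vertexFun S) h

/-- The word at the vertex `i` of the state `F_w ⋆`. -/
def starWord (w : List (Fin n)) (i : Fin n) : List (Fin n) :=
  ((starSystem n).evolution w (starState n) i).1

theorem starWord_of_notMem {w : List (Fin n)} {i : Fin n} (h : i ∉ w) : starWord w i = [] := by
  unfold starWord
  rw [evolution_eq, evalWord_updateAt_of_notMem _ _ h]
  rfl

theorem starWord_cons_of_ne {i j : Fin n} (h : j ≠ i) (w : List (Fin n)) :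
    starWord (i :: w) j = starWord w j := by
  unfold starWord
  rw [evolution_eq, evalWord_updateAt_cons, updateAt_of_ne _ h]
  rfl

theorem starWord_cons_self {i : Fin n} {l₁ l₂ : List (Fin n)}
    (h : List.finRange n = l₁ ++ i :: l₂) (w : List (Fin n)) :
    starWord (i :: w) i = i :: iteratedJoin (l₂.map (starWord w)) := by
  rw [← wordsAbove_eq_map h]
  unfold starWord
  rw [evolution_eq, evalWord_updateAt_cons, updateAt_self]
  rfl

theorem starWord_filter_lt (w : List (Fin n)) {i j : Fin n} (h : i < j) :
    starWord (w.filter (i < ·)) j = starWord w j := by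
  unfold starWord
  rw [evolution_eq, evolution_eq,
    evalWord_updateAt_filter_lt (dependsAbove_vertexFun (starSystem n)) _ _ i j h]

theorem starWord_congr {u v : List (Fin n)} (h : kiselmanEval u = kiselmanEval v) :
    starWord u = starWord v := by
  unfold starWord
  rw [evolution_congr _ h]

/-- For a canonical word `v` the iterated join of the states at the first vertices is the suffix
of `v` that begins at the first occurrence of one of these vertices. -/
theorem IsCanonical.iteratedJoin_starWord_prefix {v : List (Fin n)} (hv : IsCanonical v)
    {l₁ l₂ : List (Fin n)} (hl : List.finRange n = l₁ ++ l₂) :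
    iteratedJoin (l₁.map (starWord v)) = v.dropWhile (· ∉ l₁) := by
  -- The word and the initial segment both vary: the induction hypothesis is needed for the tail
  -- with the vertices below `i`, and for the shorter word `z ++ Q` with all vertices.
  induction hlen : v.length using Nat.strong_induction_on generalizing v l₁ l₂ with
  | _ m ih =>
  cases v with
  | nil =>
    refine iteratedJoin_of_forall_nil fun x hx => ?_
    obtain ⟨i, -, rfl⟩ := List.mem_map.1 hx
    exact starWord_of_notMem (by simp)
  | cons i v =>
  have hv' : IsCanonical v := hv.infix ⟨[i], [], by simp⟩
  have hm : v.length < m := by subst hlen; simp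
  by_cases hi : i ∈ l₁
  · obtain ⟨a, b, rfl⟩ := List.append_of_mem hi
    have hsplit : List.finRange n = a ++ i :: (b ++ l₂) := by simpa using hl
    obtain ⟨hlt, hgt⟩ := finRange_split hsplit
    have hfull : ∀ w : List (Fin n), w.length < m → IsCanonical w →
        iteratedJoin ((List.finRange n).map (starWord w)) = w := by
      intro w hw hcan
      rw [ih _ hw hcan (l₂ := []) (by simp) rfl]
      cases w <;> simp
    have hmem : ∀ w : List (Fin n), w.length < m → IsCanonical w → ∀ j,
        (starWord w j).Sublist w := by
      intro w hw hcan j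
      conv_rhs => rw [← hfull w hw hcan]
      exact sublist_iteratedJoin (List.mem_map.2 ⟨j, List.mem_finRange j, rfl⟩)
    set z := v.takeWhile (· ∉ a) with hzdef
    set P := v.dropWhile (· ∉ a) with hPdef
    have hzP : z ++ P = v := List.takeWhile_append_dropWhile
    have hza : ∀ g ∈ z, g ∉ a := fun g hg => by simpa using List.mem_takeWhile_imp hg
    have hmem_a : ∀ k, k < i → k ∈ a := by
      intro k hk
      have : k ∈ a ++ i :: (b ++ l₂) := hsplit ▸ List.mem_finRange k
      rcases List.mem_append.1 this with h | h
      · exact h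
      · rcases List.mem_cons.1 h with rfl | h
        · exact absurd hk (lt_irrefl _)
        · exact absurd hk (hgt k h).le.not_gt
    -- No letter of `z` is below `i` by the choice of `z`, and a second `i` would close a block
    -- without a smaller letter.
    have hz : ∀ g ∈ z, i < g := by
      intro g hg
      refine lt_of_le_of_ne (not_lt.1 fun h => hza g hg (hmem_a g h)) ?_
      rintro rfl
      obtain ⟨x, y, hxy, -⟩ := List.eq_append_cons_of_mem hg
      obtain ⟨-, k, hk, hki⟩ := hv i x ⟨[], y ++ P, by rw [← hzP, hxy]; simp⟩
      exact hza k (by rw [hxy]; simp [hk]) (hmem_a k hki)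
    have hcr := isCanonical_iff.1 hv'
    have hfilter : v.filter (i < ·) = z ++ P.filter (i < ·) := by
      rw [← hzP, List.filter_append, List.filter_eq_self.2 fun g hg => by simpa using hz g hg]
    obtain ⟨Q, hQP, hQcan, hQ⟩ := LeftReduced.exists_isCanonical_append z (P.filter (i < ·))
      (hfilter ▸ hcr.1.filter_lt i) (hcr.2.infix ⟨[], P, by simpa using hzP⟩)
    have hQP' : Q.Sublist P := hQP.trans List.filter_sublist
    rw [← hfilter] at hQ
    have hzQ : (z ++ Q).length < m := by
      refine lt_of_le_of_lt ?_ hm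
      rw [← hzP]
      exact (hQP'.append_left z).length_le
    -- Above `i` the entries for `v` are those for its filtered word, hence those for the canonical
    -- word `z ++ Q`. The vertices up to `i` do not occur in the filtered word, so their entries are
    -- empty and the full join reduces to this one.
    have habove : iteratedJoin ((b ++ l₂).map (starWord v)) = z ++ Q := by
      rw [← hfull _ hzQ hQcan, starWord_congr hQ, hsplit, List.append_cons a i,
        List.map_append (l₁ := a ++ [i]),
        iteratedJoin_append_of_forall_nil]
      · congr 1
        exact List.map_congr_left fun j hj => (starWord_filter_lt v (hgt j hj)).symm
      · intro x hx
        obtain ⟨j, hj, rfl⟩ := List.mem_map.1 hx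
        refine starWord_of_notMem fun h => ?_
        have h' : i < j := by simpa using (List.mem_filter.1 h).2
        rcases List.mem_append.1 hj with hj | hj
        · exact absurd h' (hlt j hj).le.not_gt
        · obtain rfl : j = i := by simpa using hj
          exact lt_irrefl _ h'
    have hbelow : iteratedJoin (a.map (starWord (i :: v))) = P := by
      rw [hPdef, ← ih _ hm hv' hsplit rfl]
      congr 1
      exact List.map_congr_left fun j hj => starWord_cons_of_ne (hlt j hj).ne v
    obtain ⟨z', c, hc⟩ : ∃ z' c, i :: z = z' ++ [c] :=
      ⟨_, _, (List.dropLast_append_getLast (List.cons_ne_nil i z)).symm⟩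
    have hnot : ¬ (c :: Q).Sublist P := by
      refine IsCanonical.not_cons_sublist (i := i) (z := z) ?_ hz hc (by rw [hQ, hzP])
      rw [List.cons_append, hzP]
      exact hv
    have hjoin : join (starWord (i :: v) i) P = i :: v := by
      rw [starWord_cons_self hsplit, habove]
      have h1 : i :: (z ++ Q) = z' ++ c :: Q := by
        rw [← List.cons_append, hc]; simp
      have h2 : i :: v = z' ++ c :: P := by
        rw [← hzP, ← List.cons_append, hc]; simp
      rw [h1, h2, join_append_cons hQP' hnot]
    rw [List.map_append, List.map_cons, iteratedJoin_append_cons, hbelow, hjoin,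
      foldl_join_of_sublist]
    · simp
    -- The entries at the remaining vertices of the segment, all above `i`, are subsequences of the
    -- tail `v`, so the join absorbs them.
    · intro x hx
      obtain ⟨j, hj, rfl⟩ := List.mem_map.1 hx
      rw [starWord_cons_of_ne (hgt j (by simp [hj])).ne']
      exact (hmem v hm hv' j).trans (List.sublist_cons_self i v)
  · rw [List.dropWhile_cons_of_pos (by simpa using hi), ← ih _ hm hv' hl rfl]
    congr 1
    exact List.map_congr_left fun j hj =>
      starWord_cons_of_ne (by rintro rfl; exact hi hj) v

/-- A canonical word is the iterated join of the vertex states of `F_v ⋆`. -/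
theorem IsCanonical.iteratedJoin_starWord {v : List (Fin n)} (hv : IsCanonical v) :
    iteratedJoin (List.ofFn (starWord v)) = v := by
  rw [List.ofFn_eq_map, hv.iteratedJoin_starWord_prefix (l₂ := []) (by simp)]
  cases v <;> simp

/-! ### Uniqueness of canonical words and faithfulness of the action -/

theorem IsCanonical.eq_of_kiselmanEval_eq {u v : List (Fin n)} (hu : IsCanonical u)
    (hv : IsCanonical v) (h : kiselmanEval u = kiselmanEval v) : u = v := by
  rw [← hu.iteratedJoin_starWord, ← hv.iteratedJoin_starWord, starWord_congr h]

theorem isCanonical_canonicalForm (w : List (Fin n)) : IsCanonical (canonicalForm w) :=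
  (exists_isCanonical w).choose_spec.1

theorem kiselmanEval_canonicalForm (w : List (Fin n)) :
    kiselmanEval (canonicalForm w) = kiselmanEval w :=
  (exists_isCanonical w).choose_spec.2

theorem canonicalForm_eq_iteratedJoin (w : List (Fin n)) :
    canonicalForm w = iteratedJoin (List.ofFn (starWord w)) := by
  rw [← starWord_congr (kiselmanEval_canonicalForm w),
    (isCanonical_canonicalForm w).iteratedJoin_starWord]

theorem evolution_eq_iff_kiselmanEval_eq {u v : List (Fin n)} :
    (starSystem n).evolution u = (starSystem n).evolution v ↔
      kiselmanEval u = kiselmanEval v := by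
  refine ⟨fun h => ?_, evolution_congr _⟩
  have : starWord u = starWord v := by unfold starWord; rw [h]
  rw [← kiselmanEval_canonicalForm u, ← kiselmanEval_canonicalForm v,
    canonicalForm_eq_iteratedJoin, canonicalForm_eq_iteratedJoin, this]

theorem canonicalForm_eq_iff {u v : List (Fin n)} :
    canonicalForm u = canonicalForm v ↔ kiselmanEval u = kiselmanEval v := by
  refine ⟨fun h => ?_, fun h => ?_⟩
  · rw [← kiselmanEval_canonicalForm u, h, kiselmanEval_canonicalForm]
  · exact (isCanonical_canonicalForm u).eq_of_kiselmanEval_eq (isCanonical_canonicalForm v)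
      (by rw [kiselmanEval_canonicalForm, h, kiselmanEval_canonicalForm])

end starSystem

/-! ## The monoids -/

section monoids

variable {n : ℕ}

theorem PresentedMonoid.exists_evalWord {α : Type*} {r : FreeMonoid α → FreeMonoid α → Prop}
    (x : PresentedMonoid r) : ∃ w : List α, evalWord (PresentedMonoid.of r) w = x := by
  obtain ⟨w, rfl⟩ := PresentedMonoid.surjective_mk x
  refine ⟨FreeMonoid.toList w, ?_⟩
  rw [← lift_evalWord, FreeMonoid.ofList_toList]
  refine congrArg (fun φ : FreeMonoid α →* PresentedMonoid r => φ w) (FreeMonoid.hom_eq ?_)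
  intro a
  simp [PresentedMonoid.of]

/-- The representation of Kiselman's semigroup by evolutions of the star system. -/
def starAction (n : ℕ) : Kiselman n →* Function.End (starSystem n).SystemState :=
  kiselmanAction _ (dependsAbove_vertexFun (starSystem n))

theorem starAction_gen (i : Fin n) : starAction n (Kiselman.gen i) = (starSystem n).localFun i :=
  kiselmanAction_gen _ _ i

theorem starAction_eval (w : List (Fin n)) :
    starAction n (kiselmanEval w) = (starSystem n).evolution w :=
  kiselmanAction_eval _ _ w

theorem starAction_injective (n : ℕ) : Function.Injective (starAction n) := by
  intro x y h
  obtain ⟨u, rfl⟩ := PresentedMonoid.exists_evalWord x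
  obtain ⟨v, rfl⟩ := PresentedMonoid.exists_evalWord y
  change starAction n (kiselmanEval u) = starAction n (kiselmanEval v) at h
  rw [starAction_eval, starAction_eval] at h
  exact evolution_eq_iff_kiselmanEval_eq.1 h

theorem mrange_starAction (n : ℕ) :
    MonoidHom.mrange (starAction n) = (starSystem n).dynamicsMonoid := by
  have htop : Submonoid.closure (Set.range (Kiselman.gen (n := n))) = ⊤ :=
    PresentedMonoid.closure_range_of (KiselmanRel n)
  rw [MonoidHom.mrange_eq_map, ← htop, MonoidHom.map_mclosure, ← Set.range_comp]
  congr 2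

/-- Kiselman's semigroup is the Hecke-Kiselman monoid of the complete acyclic oriented graph. -/
def heckeKiselmanToKiselman (n : ℕ) : HeckeKiselman (completeOriented n) →* Kiselman n :=
  PresentedMonoid.lift Kiselman.gen fun a b h => by
    cases h with
    | idem i => simpa using Kiselman.gen_mul_self i
    | arrow_left i j h => simpa using Kiselman.gen_left h
    | arrow_right i j h => simpa using Kiselman.gen_right h
    | comm i j h₁ h₂ =>
      -- Non-adjacent vertices of the complete graph coincide, so the commutation relation is
      -- trivial.
      obtain rfl : i = j := le_antisymm (not_lt.1 h₂) (not_lt.1 h₁)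
      rfl

theorem heckeKiselmanToKiselman_eval (w : List (Fin n)) :
    heckeKiselmanToKiselman n (evalWord (HeckeKiselman.gen (completeOriented n)) w) =
      kiselmanEval w := by
  rw [map_evalWord, kiselmanEval]
  congr 1

/-- The inverse of `heckeKiselmanToKiselman`. -/
def kiselmanToHeckeKiselman (n : ℕ) : Kiselman n →* HeckeKiselman (completeOriented n) :=
  PresentedMonoid.lift (HeckeKiselman.gen _) fun a b h => by
    cases h with
    | idem i => exact PresentedMonoid.mk_eq_mk_of_rel (HeckeKiselmanRel.idem i)
    | left i j h =>
      exact PresentedMonoid.mk_eq_mk_of_rel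
        (HeckeKiselmanRel.arrow_left (Γ := completeOriented n) i j h)
    | right i j h =>
      exact PresentedMonoid.mk_eq_mk_of_rel
        (HeckeKiselmanRel.arrow_right (Γ := completeOriented n) i j h)

theorem kiselmanToHeckeKiselman_eval (w : List (Fin n)) :
    kiselmanToHeckeKiselman n (kiselmanEval w) =
      evalWord (HeckeKiselman.gen (completeOriented n)) w := by
  rw [kiselmanEval, map_evalWord]
  congr 1

end monoids

end KiselmanDynamics

/-! ### The main theorem -/

theorem mainTheorem1 (n : ℕ) :
    -- the canonical form is the unique canonical word in its fibre
    (∀ w v : List (Fin n),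
      (IsCanonical v ∧ kiselmanEval v = kiselmanEval w) ↔ v = canonicalForm w) ∧
    -- the canonical form is the iterated join of the vertex states
    (∀ w : List (Fin n),
      canonicalForm w = iteratedJoin
        (List.ofFn fun i : Fin n => ((starSystem n).evolution w (starState n) i).1)) ∧
    (∀ u v : List (Fin n),
      (starSystem n).evolution u = (starSystem n).evolution v ↔
        canonicalForm u = canonicalForm v) ∧
    -- the dynamics monoid is isomorphic to Kiselman's semigroup
    (∃ e : Kiselman n ≃* (starSystem n).dynamicsMonoid, ∀ i : Fin n,
      (e (Kiselman.gen i) : Function.End (starSystem n).SystemState) =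
        (starSystem n).localFun i) ∧
    -- the evaluation factors through the Hecke-Kiselman monoid of the graph, and through no
    -- nontrivial quotient of it
    (∃ φ : HeckeKiselman (completeOriented n) →* Function.End (starSystem n).SystemState,
      ∀ w : List (Fin n),
        φ (evalWord (HeckeKiselman.gen (completeOriented n)) w) = (starSystem n).evolution w) ∧
    (∀ c : Con (HeckeKiselman (completeOriented n)),
      (∃ φ : c.Quotient →* Function.End (starSystem n).SystemState, ∀ w : List (Fin n),
        φ (c.mk' (evalWord (HeckeKiselman.gen (completeOriented n)) w)) =
          (starSystem n).evolution w) →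
      c = ⊥) := by
  refine ⟨fun w v => ⟨fun h => ?_, ?_⟩, canonicalForm_eq_iteratedJoin, fun u v => ?_, ?_, ?_, ?_⟩
  · exact h.1.eq_of_kiselmanEval_eq (isCanonical_canonicalForm w)
      (h.2.trans (kiselmanEval_canonicalForm w).symm)
  · rintro rfl
    exact ⟨isCanonical_canonicalForm w, kiselmanEval_canonicalForm w⟩
  · rw [evolution_eq_iff_kiselmanEval_eq, canonicalForm_eq_iff]
  · refine ⟨(MulEquiv.ofBijective (starAction n).mrangeRestrict
      ⟨fun x y h => starAction_injective n (congrArg Subtype.val h),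
        (starAction n).mrangeRestrict_surjective⟩).trans
      (MulEquiv.submonoidCongr (mrange_starAction n)), fun i => ?_⟩
    exact starAction_gen i
  · refine ⟨(starAction n).comp (heckeKiselmanToKiselman n), fun w => ?_⟩
    rw [MonoidHom.comp_apply, heckeKiselmanToKiselman_eval, starAction_eval]
  · rintro c ⟨φ, hφ⟩
    refine le_antisymm (fun x y hxy => ?_) bot_le
    obtain ⟨u, rfl⟩ := PresentedMonoid.exists_evalWord x
    obtain ⟨v, rfl⟩ := PresentedMonoid.exists_evalWord y
    have h : (starSystem n).evolution u = (starSystem n).evolution v := by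
      rw [← hφ, ← hφ]
      exact congrArg φ ((Con.eq c).2 hxy)
    -- Faithfulness gives equality in K_n, which is transported back to the Hecke-Kiselman monoid.
    have h' := congrArg (kiselmanToHeckeKiselman n) (evolution_eq_iff_kiselmanEval_eq.1 h)
    rw [kiselmanToHeckeKiselman_eval, kiselmanToHeckeKiselman_eval] at h'
    exact h'
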